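/- An $(\alpha,\beta)$-spanner of a finite simple undirected unweighted graph $G=(V,E)$ is a subgraph $H=(V,E')$, $E'\subseteq E$, such that $\operatorname{dist}_H(u,v)\le \alpha\operatorname{dist}_G(u,v)+\beta$ for all $u,v\in V$ that are connected in $G$; its size is $|E'|$. An $(\alpha,\beta)$-spanner construction for $n$-vertex graphs assigns to every graph $G$ on $n$ vertices an $(\alpha,\beta)$-spanner of $G$; its worst-case size is the maximum size of these spanners. Theorem ($(1+\epsilon,\beta)$-Spanner Lower Bounds). Any $(1+\epsilon,\beta)$-spanner construction with worst-case size at most $n^{1+\frac{1}{2^{k}-1}-\delta}$, $\delta>0$, has $\beta=\Omega\left(\frac{1}{\epsilon(k-1)}\right)^{k-1}$. Precisely: there is an absolute constant $c>0$ such that for every integer $k\ge 2$, every real $0<\epsilon\le 1$ and every real $\delta>0$ the following holds for all sufficiently large $n$ (depending on $k,\epsilon,\delta$). If $\beta\in\mathbb{R}$ and there is a $(1+\epsilon,\beta)$-spanner construction for $n$-vertex graphs with worst-case size at most $n^{1+\frac{1}{2^{k}-1}-\delta}$, then $$\beta\ \ge\ \left(\frac{c}{\epsilon(k-1)}\right)^{k-1},$$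 and if moreover $\epsilon(k-1)\le c$, then also $$\beta\ \ge\ c\left(\frac{1}{\epsilon(k-1)}\right)^{k-1}.$$ In particular, both bounds hold for constructions with worst-case size at most $n^{1+\frac{1}{2^{k+1}-1}-\delta}$. -/

import Mathlib

/-- `H` is an `(α, β)`-spanner of `G`: a subgraph of `G` on the same vertex set in which the
distance of any two vertices is at most `α` times their distance in `G`, plus `β`.
(Two vertices in different components of `G` have infinite distance in `G`, so such a pair imposes
no condition; two vertices connected in `G` have to be connected in `H`.) -/
def IsSpanner {V : Type*} (α β : ℝ) (G H : SimpleGraph V) : Prop :=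
  H ≤ G ∧ ∀ u v : V, G.Reachable u v →
    H.Reachable u v ∧ (H.dist u v : ℝ) ≤ α * (G.dist u v : ℝ) + β

/-- `A` is an `(α, β)`-spanner construction for `n`-vertex graphs with worst-case size at most `s`:
it assigns to every graph on `n` vertices an `(α, β)`-spanner with at most `s` edges. -/
def IsSpannerConstruction (n : ℕ) (α β s : ℝ)
    (A : SimpleGraph (Fin n) → SimpleGraph (Fin n)) : Prop :=
  ∀ G : SimpleGraph (Fin n), IsSpanner α β G (A G) ∧ ((A G).edgeSet.ncard : ℝ) ≤ s

/-- `y` can be reached from `x` by at most `n` steps along `R`, each in either direction. -/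
def Near {V : Type} (R : V → V → Prop) (n : ℕ) (x y : V) : Prop :=
  ∃ w : (SimpleGraph.fromRel R).Walk x y, w.length ≤ n

namespace Near

variable {V W : Type} {R : V → V → Prop} {x y z : V} {m n : ℕ}

theorem refl (x : V) : Near R 0 x x := ⟨.nil, le_rfl⟩

theorem symm (h : Near R n x y) : Near R n y x := by
  obtain ⟨w, hw⟩ := h
  exact ⟨w.reverse, by simpa using hw⟩

theorem trans (h₁ : Near R m x y) (h₂ : Near R n y z) : Near R (m + n) x z := by
  obtain ⟨w₁, h₁⟩ := h₁
  obtain ⟨w₂, h₂⟩ := h₂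
  exact ⟨w₁.append w₂, by rw [SimpleGraph.Walk.length_append]; omega⟩

theorem of_rel (h : R x y) : Near R 1 x y := by
  by_cases hxy : x = y
  · subst hxy
    exact ⟨.nil, by simp⟩
  · exact ⟨.cons (by rw [SimpleGraph.fromRel_adj]; exact ⟨hxy, .inl h⟩) .nil, by simp⟩

theorem map {R' : W → W → Prop} (f : V → W) (hf : ∀ x y, R x y → R' (f x) (f y))
    (h : Near R n x y) : Near R' n (f x) (f y) := by
  obtain ⟨w, hw⟩ := h
  induction w generalizing n with
  | nil => exact ⟨.nil, by simp⟩
  | @cons a b c hab w ih =>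
    rw [SimpleGraph.Walk.length_cons] at hw
    obtain ⟨n, rfl⟩ : ∃ n', n = 1 + n' := ⟨n - 1, by omega⟩
    refine Near.trans ?_ (ih (n := n) (by omega))
    rw [SimpleGraph.fromRel_adj] at hab
    rcases hab.2 with h | h
    · exact of_rel (hf _ _ h)
    · exact (of_rel (hf _ _ h)).symm

end Near

/-! ### Gadgets and the complete bipartite base case -/

/-- A graph with labelled inputs and outputs and with a family of input-output pairs at distance
`D` (at most `D` by `near`, at least `D` by `level`). Each pair owns a set of critical edges, and
the potential `pot p` shows that without these edges the distance grows to at least `D + 2 * e`. -/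
structure SpannerGadget (D e : ℕ) (L P V : Type) where
  rel : V → V → Prop
  crit : P → V → V → Prop
  inp : L → V
  out : L → V
  src : P → L
  tgt : P → L
  crit_unique : ∀ p q x y, crit p x y → (crit q x y ∨ crit q y x) → p = q
  near : ∀ p, Near rel D (inp (src p)) (out (tgt p))
  level : V → ℤ
  level_rel : ∀ x y, rel x y → |level x - level y| ≤ 1
  level_inp : ∀ l, level (inp l) = 0
  level_out : ∀ l, level (out l) = D
  pot : P → V → ℤ
  pot_rel : ∀ p x y, rel x y → ¬ crit p x y → |pot p x - pot p y| ≤ 1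
  pot_src : ∀ p, pot p (inp (src p)) = 0
  pot_tgt : ∀ p, pot p (out (tgt p)) = D + 2 * e
  pot_inp : ∀ p l, 0 ≤ pot p (inp l) ∧ pot p (inp l) ≤ 2 * e
  pot_out : ∀ p l, D ≤ pot p (out l) ∧ pot p (out l) ≤ D + 2 * e

namespace SpannerGadget

open Classical in
/-- The complete bipartite graph, in which each edge is critical for the pair of its ends. -/
noncomputable def biclique (L : Type) : SpannerGadget 1 1 L (L × L) (L ⊕ L) where
  rel x y := ∃ a b, x = .inl a ∧ y = .inr b
  crit p x y := x = .inl p.1 ∧ y = .inr p.2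
  inp := .inl
  out := .inr
  src := Prod.fst
  tgt := Prod.snd
  crit_unique := by
    rintro ⟨a, b⟩ ⟨a', b'⟩ x y ⟨rfl, rfl⟩ h
    simpa using h
  near p := Near.of_rel ⟨_, _, rfl, rfl⟩
  level := Sum.elim (fun _ => 0) (fun _ => 1)
  level_rel := by
    rintro _ _ ⟨a, b, rfl, rfl⟩
    simp
  level_inp _ := rfl
  level_out _ := rfl
  -- Distances from the source once the edge `p` is gone: the target is reached only by a detour
  -- with three edges.
  pot p := Sum.elim (fun a => if a = p.1 then 0 else 2) (fun b => if b = p.2 then 3 else 1)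
  pot_rel := by
    rintro ⟨a', b'⟩ _ _ ⟨a, b, rfl, rfl⟩ h
    simp only [Sum.inl.injEq, Sum.inr.injEq, not_and, Sum.elim_inl, Sum.elim_inr] at h ⊢
    split_ifs <;> simp_all
  pot_src p := by simp
  pot_tgt p := by simp
  pot_inp p l := by simp only [Sum.elim_inl]; split_ifs <;> simp
  pot_out p l := by simp only [Sum.elim_inr]; split_ifs <;> simp

variable {D e : ℕ} {L P V : Type} (g : SpannerGadget D e L P V)

/-! The gadget read from inputs to outputs for even `i`, and from outputs to inputs for odd `i`. -/

def port (i : ℕ) (l : L) : V := if Even i then g.inp l else g.out l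

def label (p : P) (i : ℕ) : L := if Even i then g.src p else g.tgt p

def levelAt (i : ℕ) (x : V) : ℤ := if Even i then g.level x else D - g.level x

def potAt (i : ℕ) (p : P) (x : V) : ℤ := if Even i then g.pot p x else D + 2 * e - g.pot p x

theorem levelAt_rel (i : ℕ) {x y : V} (h : g.rel x y) :
    |g.levelAt i x - g.levelAt i y| ≤ 1 := by
  have := g.level_rel x y h
  unfold levelAt
  rw [abs_le] at *
  split_ifs <;> constructor <;> linarith

theorem potAt_rel (i : ℕ) {p : P} {x y : V} (h : g.rel x y) (hc : ¬ g.crit p x y) :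
    |g.potAt i p x - g.potAt i p y| ≤ 1 := by
  have := g.pot_rel p x y h hc
  unfold potAt
  rw [abs_le] at *
  split_ifs <;> constructor <;> linarith

theorem levelAt_port (i : ℕ) (l : L) : g.levelAt i (g.port i l) = 0 := by
  unfold levelAt port
  split_ifs <;> simp [g.level_inp, g.level_out]

theorem levelAt_port_succ (i : ℕ) (l : L) : g.levelAt i (g.port (i + 1) l) = D := by
  unfold levelAt port
  by_cases h : Even i <;> simp [h, Nat.even_add_one, g.level_inp, g.level_out]

theorem potAt_label (i : ℕ) (p : P) : g.potAt i p (g.port i (g.label p i)) = 0 := by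
  unfold potAt port label
  split_ifs <;> simp [g.pot_src, g.pot_tgt]

theorem potAt_label_succ (i : ℕ) (p : P) :
    g.potAt i p (g.port (i + 1) (g.label p (i + 1))) = D + 2 * e := by
  unfold potAt port label
  by_cases h : Even i <;> simp [h, Nat.even_add_one, g.pot_src, g.pot_tgt]

theorem potAt_port (i : ℕ) (p : P) (l : L) :
    0 ≤ g.potAt i p (g.port i l) ∧ g.potAt i p (g.port i l) ≤ 2 * e := by
  have h₁ := g.pot_inp p l
  have h₂ := g.pot_out p l
  unfold potAt port
  split_ifs
  · exact h₁
  · constructor <;> linarith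

theorem potAt_port_succ (i : ℕ) (p : P) (l : L) :
    D ≤ g.potAt i p (g.port (i + 1) l) ∧ g.potAt i p (g.port (i + 1) l) ≤ D + 2 * e := by
  have h₁ := g.pot_inp p l
  have h₂ := g.pot_out p l
  unfold potAt port
  by_cases h : Even i <;> simp only [h, Nat.even_add_one, if_true, if_false, not_true, not_false_iff]
  · exact h₂
  · constructor <;> linarith

theorem near_port (i : ℕ) (p : P) :
    Near g.rel D (g.port i (g.label p i)) (g.port (i + 1) (g.label p (i + 1))) := by
  unfold port label
  by_cases h : Even i <;> simp only [h, Nat.even_add_one, if_true, if_false, not_true, not_false_iff]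
  · exact g.near p
  · exact (g.near p).symm

/-! ### Lattice paths and potentials -/

/-- The step vectors of the composition alternate between `a` and `b`. -/
def step {Z : Type} (a b : L → Z) (i : ℕ) (l : L) : Z := if Even i then a l else b l

variable {Z : Type} [AddCommGroup Z] (a b : L → Z)

/-- The displacement after `i` steps along the path of the pair `p`. -/
def offset (p : P) : ℕ → Z
  | 0 => 0
  | i + 1 => offset p i + step a b i (g.label p i)

open Classical in
/-- The penalty of a position off the path: nothing if it lies below the current position of the
path with respect to the functional `Φ`, and `2 * w` otherwise. -/
noncomputable def penalty (w : ℕ) (Φ : Z →+ ℤ) (z₀ z : Z) : ℤ := if Φ z < Φ z₀ then 0 else 2 * w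

theorem penalty_mem (w : ℕ) (Φ : Z →+ ℤ) (z₀ z : Z) :
    0 ≤ penalty w Φ z₀ z ∧ penalty w Φ z₀ z ≤ 2 * w := by
  unfold penalty
  split_ifs <;> constructor <;> linarith [Int.natCast_nonneg w]

open Classical in
/-- The potential in the copy of the gadget with index `i` at the position `z`. -/
noncomputable def nodePot (w : ℕ) (Φ : Z →+ ℤ) (s : Z) (p : P) (i : ℕ) (z : Z) (x : V) : ℤ :=
  ((i : ℤ) + 1) * w + i * D +
    if z = s + g.offset a b p (i + 1) then (i : ℤ) * (2 * e) + g.potAt i p x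
    else penalty w Φ (s + g.offset a b p (i + 1)) z + g.levelAt i x

open Classical in
/-- The potential at a hub in step `i`, with value `c` on the path. -/
noncomputable def hubPot (w : ℕ) (Φ : Z →+ ℤ) (s : Z) (p : P) (i : ℕ) (c : ℤ) (z : Z) : ℤ :=
  if z = s + g.offset a b p i then c else penalty w Φ (s + g.offset a b p i) z

/-- The potential at the beginning of the edge with label `l` that leaves `z` in step `i`. -/
noncomputable def leftPot (w : ℕ) (Φ : Z →+ ℤ) (s : Z) (p : P) : ℕ → Z → L → ℤ
  | 0, z, _ => g.hubPot a b w Φ s p 0 0 z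
  | i + 1, z, l => g.nodePot a b w Φ s p i z (g.port (i + 1) l)

/-- The potential at the end of the edge with label `l` that enters `z` in step `i`. -/
noncomputable def rightPot (w n : ℕ) (Φ : Z →+ ℤ) (s : Z) (p : P) (i : ℕ) (z : Z) (l : L) : ℤ :=
  if i = n then ((n : ℤ) + 1) * w + n * D + g.hubPot a b w Φ s p (n + 1) (2 * w) z
  else g.nodePot a b w Φ s p i z (g.port i l)

variable {g a b} {w n : ℕ} {Φ : Z →+ ℤ} {s : Z} {p : P}

/-- Here `μ` is the excess of the potential over the undisturbed distance `i * (w + D)`. On the path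
it grows by `2 * e` per crossed copy; `n * e = w` keeps it within the range of the penalty. -/
theorem leftPot_spec (hw : n * e = w) {i : ℕ} (hi : i ≤ n) (z : Z) (l : L) :
    ∃ μ : ℤ, g.leftPot a b w Φ s p i z l = i * (w + D) + μ ∧ 0 ≤ μ ∧ μ ≤ 2 * w ∧
      (z = s + g.offset a b p i → l = g.label p i → μ = i * (2 * e)) ∧
      (z ≠ s + g.offset a b p i → μ = penalty w Φ (s + g.offset a b p i) z) := by
  classical
  cases i with
  | zero =>
    have := penalty_mem w Φ (s + g.offset a b p 0) z
    refine ⟨g.hubPot a b w Φ s p 0 0 z, by simp [leftPot], ?_, ?_, ?_, ?_⟩ <;>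
      unfold hubPot <;> split_ifs <;> simp_all
  | succ i =>
    have hle : ((i : ℤ) + 1) * e ≤ w := by
      rw [← hw]
      exact_mod_cast Nat.mul_le_mul_right e hi
    have hie : 0 ≤ (i : ℤ) * (2 * e) := by positivity
    have hport := g.potAt_port_succ i p l
    have hpen := penalty_mem w Φ (s + g.offset a b p (i + 1)) z
    refine ⟨g.leftPot a b w Φ s p (i + 1) z l - (i + 1 : ℕ) * (w + D), by ring, ?_⟩
    simp only [leftPot, nodePot, levelAt_port_succ]
    push_cast
    split_ifs with h
    · refine ⟨by linarith, by linarith, ?_, fun h' => absurd h h'⟩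
      rintro - rfl
      rw [potAt_label_succ]
      ring
    · exact ⟨by linarith, by linarith, fun h' => absurd h' h, fun _ => by ring⟩

theorem rightPot_spec (hw : n * e = w) {i : ℕ} (hi : i ≤ n) (z : Z) (l : L) :
    ∃ μ : ℤ, g.rightPot a b w n Φ s p i z l = w + i * (w + D) + μ ∧ 0 ≤ μ ∧ μ ≤ 2 * w ∧
      (z = s + g.offset a b p (i + 1) → l = g.label p i → μ = i * (2 * e)) ∧
      (z ≠ s + g.offset a b p (i + 1) → μ = penalty w Φ (s + g.offset a b p (i + 1)) z) := by
  classical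
  have hpen := penalty_mem w Φ (s + g.offset a b p (i + 1)) z
  refine ⟨g.rightPot a b w n Φ s p i z l - (w + i * (w + D)), by ring, ?_⟩
  by_cases hin : i = n
  · subst hin
    -- The value `2 * w` of the last hub on the path is the excess collected in all `n` copies.
    have hle : (i : ℤ) * e = w := by exact_mod_cast hw
    simp only [rightPot, if_true, hubPot]
    split_ifs with h
    · exact ⟨by linarith, by linarith, fun _ _ => by linarith, fun h' => absurd h h'⟩
    · exact ⟨by linarith, by linarith, fun h' => absurd h' h, fun _ => by ring⟩
  · have hle : ((i : ℤ) + 1) * e ≤ w := by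
      rw [← hw]
      exact_mod_cast Nat.mul_le_mul_right e (show i + 1 ≤ n by omega)
    have hie : 0 ≤ (i : ℤ) * (2 * e) := by positivity
    have hport := g.potAt_port i p l
    simp only [rightPot, if_neg hin, nodePot, levelAt_port]
    split_ifs with h
    · refine ⟨by linarith, by linarith, ?_, fun h' => absurd h h'⟩
      rintro - rfl
      rw [potAt_label]
      ring
    · exact ⟨by linarith, by linarith, fun h' => absurd h' h, fun _ => by ring⟩

/-- The functional `Φ` is maximal on the steps of the pair `p`, and nowhere else. -/
def Exposes (g : SpannerGadget D e L P V) (a b : L → Z) (Φ : Z →+ ℤ) (p : P) : Prop :=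
  (∀ l, l ≠ g.src p → Φ (a l) < Φ (a (g.src p))) ∧ ∀ l, l ≠ g.tgt p → Φ (b l) < Φ (b (g.tgt p))

theorem Exposes.lt (h : g.Exposes a b Φ p) (i : ℕ) {l : L} (hl : l ≠ g.label p i) :
    Φ (step a b i l) < Φ (step a b i (g.label p i)) := by
  unfold step
  unfold label at hl ⊢
  split_ifs at hl ⊢
  · exact h.1 l hl
  · exact h.2 l hl

/-- Along a connecting edge the excess cannot increase: a wrong step from the path, or any step from
below it, ends strictly below the path, where the excess is `0`. It also drops by at most `2 * w`,
so the potential changes by `w + ν - μ`, which lies between `-w` and `w`. -/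
theorem abs_rightPot_sub_leftPot_le (hw : n * e = w) (hΦ : g.Exposes a b Φ p) {i : ℕ} (hi : i ≤ n)
    (z : Z) (l : L) :
    |g.rightPot a b w n Φ s p i (z + step a b i l) l - g.leftPot a b w Φ s p i z l| ≤ w := by
  obtain ⟨μ, h, h0, h2, hpath, hoff⟩ := leftPot_spec (g := g) (a := a) (b := b) (Φ := Φ) (s := s)
    (p := p) hw hi z l
  obtain ⟨ν, h', h0', h2', hpath', hoff'⟩ := rightPot_spec (g := g) (a := a) (b := b) (Φ := Φ)
    (s := s) (p := p) hw hi (z + step a b i l) l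
  have key : ν ≤ μ := by
    have below : Φ (z + step a b i l) < Φ (s + g.offset a b p (i + 1)) → ν = 0 := by
      intro hlt
      rw [hoff' (fun heq => hlt.ne (by rw [heq])), penalty, if_pos hlt]
    have hoffset : Φ (s + g.offset a b p (i + 1)) =
        Φ (s + g.offset a b p i) + Φ (step a b i (g.label p i)) := by
      rw [offset, ← add_assoc, map_add]
    rw [map_add, hoffset] at below
    by_cases hz : z = s + g.offset a b p i
    · by_cases hl : l = g.label p i
      · rw [hpath hz hl, hpath' (by rw [hz, hl, offset, add_assoc]) hl]
      · have := hΦ.lt i hl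
        rw [below (by rw [hz]; linarith)]
        exact h0
    · have hμ := hoff hz
      unfold penalty at hμ
      split_ifs at hμ with hlt
      · have : Φ (step a b i l) ≤ Φ (step a b i (g.label p i)) := by
          by_cases hl : l = g.label p i
          · rw [hl]
          · exact (hΦ.lt i hl).le
        rw [below (by linarith)]
        exact h0
      · linarith
  rw [h, h', abs_le]
  constructor <;> linarith

end SpannerGadget

/-! ### The composition of a gadget with itself -/

namespace SpannerGadget

/-- The vertices of the composition: `n` layers of copies of the gadget indexed by positions, a
layer of hubs before and after them, and `m + 1` inner vertices for each connecting edge. -/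
inductive CompVert (n m : ℕ) (L V B : Type) : Type
  | hubIn (v : B)
  | hubOut (v : B)
  | node (i : Fin n) (v : B) (x : V)
  | sub (i : Fin (n + 1)) (v : B) (l : L) (j : Fin (m + 1))

variable {D e : ℕ} {L P V : Type} (g : SpannerGadget D e L P V)
variable {Z : Type} [AddCommGroup Z] (a b : L → Z) (n m : ℕ) (B : Finset Z)

open CompVert in
/-- The edges of the composition. In step `i`, the port with label `l` of the copy at position `v`
is connected to the port with the same label of the copy at position `v + step a b i l`. -/
inductive CompRel : CompVert n m L V B → CompVert n m L V B → Prop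
  | node (i : Fin n) (v : B) (x y : V) : g.rel x y → CompRel (node i v x) (node i v y)
  | sub (i : Fin (n + 1)) (v : B) (l : L) (j : Fin m) :
      CompRel (sub i v l j.castSucc) (sub i v l j.succ)
  | start (v : B) (l : L) : CompRel (hubIn v) (sub 0 v l 0)
  | leave (i : Fin n) (v : B) (l : L) :
      CompRel (node i v (g.port (i + 1) l)) (sub i.succ v l 0)
  | enter (i : Fin n) (v v' : B) (l : L) : (v' : Z) = v + step a b i l →
      CompRel (sub i.castSucc v l (Fin.last m)) (node i v' (g.port i l))
  | finish (v v' : B) (l : L) : (v' : Z) = v + step a b n l →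
      CompRel (sub (Fin.last n) v l (Fin.last m)) (hubOut v')

/-- The critical edges of a pair: those of `p` in the copies along its path from `s`. -/
def CompCrit (S : Finset Z) (q : S × P) (X Y : CompVert n m L V B) : Prop :=
  ∃ (i : Fin n) (v : B) (x y : V), (v : Z) = q.1 + g.offset a b q.2 (i + 1) ∧
    X = .node i v x ∧ Y = .node i v y ∧ g.crit q.2 x y

/-- The level function of the composition. -/
def compLevel : CompVert n m L V B → ℤ
  | .hubIn _ => 0
  | .hubOut _ => ((n : ℤ) + 1) * (m + 2) + n * D
  | .node i _ x => ((i : ℤ) + 1) * (m + 2) + i * D + g.levelAt i x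
  | .sub i _ _ j => (i : ℤ) * ((m + 2) + D) + (j + 1)

/-- The potential of a pair on the composition. -/
noncomputable def compPot (Φ : Z →+ ℤ) (s : Z) (p : P) : CompVert n m L V B → ℤ
  | .hubIn v => g.hubPot a b (m + 2) Φ s p 0 0 v
  | .hubOut v => ((n : ℤ) + 1) * (m + 2 : ℕ) + n * D +
      g.hubPot a b (m + 2) Φ s p (n + 1) (2 * (m + 2 : ℕ)) v
  | .node i v x => g.nodePot a b (m + 2) Φ s p i v x
  | .sub i v l j => min (g.leftPot a b (m + 2) Φ s p i v l + (j + 1))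
      (g.rightPot a b (m + 2) n Φ s p i (v + step a b i l) l + (m + 1 - j))

variable {g a b n m B}

theorem compLevel_rel {X Y : CompVert n m L V B} (h : g.CompRel a b n m B X Y) :
    |g.compLevel n m B X - g.compLevel n m B Y| ≤ 1 := by
  cases h with
  | node i v x y h => simpa [compLevel] using g.levelAt_rel i h
  | sub i v l j => simp [compLevel]
  | start v l => simp [compLevel]
  | leave i v l =>
    simp only [compLevel, levelAt_port_succ, Fin.val_succ, Fin.val_zero]
    push_cast
    ring_nf
    norm_num
  | enter i v v' l _ =>
    simp only [compLevel, levelAt_port, Fin.val_castSucc, Fin.val_last]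
    ring_nf
    norm_num
  | finish v v' l _ =>
    simp only [compLevel, Fin.val_last]
    ring_nf
    norm_num

/-- On a connecting edge the potential is the minimum of the two cones from its ends, which fits
both ends because their values differ by at most its length `m + 2`. Inside copies on the path the
potential of `p` applies, elsewhere the level does. -/
theorem compPot_rel {S : Finset Z} (hw : n * e = m + 2) {Φ : Z →+ ℤ} {q : S × P}
    (hΦ : g.Exposes a b Φ q.2) {X Y : CompVert n m L V B} (h : g.CompRel a b n m B X Y)
    (hc : ¬ g.CompCrit a b n m B S q X Y) :
    |g.compPot a b n m B Φ q.1 q.2 X - g.compPot a b n m B Φ q.1 q.2 Y| ≤ 1 := by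
  classical
  obtain ⟨s, p⟩ := q
  have edge : ∀ {i : ℕ}, i ≤ n → ∀ (z : Z) (l : L), _ := fun {i} hi z l =>
    abs_rightPot_sub_leftPot_le (g := g) (s := (s : Z)) hw hΦ (i := i) hi z l
  cases h with
  | node i v x y h =>
    simp only [compPot, nodePot]
    split_ifs with hv
    · have := g.potAt_rel i (p := p) h (fun hxy => hc ⟨i, v, x, y, hv, rfl, rfl, hxy⟩)
      rw [abs_le] at *
      constructor <;> linarith
    · have := g.levelAt_rel i h
      rw [abs_le] at *
      constructor <;> linarith
  | sub i v l j =>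
    simp only [compPot, Fin.val_castSucc, Fin.val_succ]
    refine (abs_min_sub_min_le_max _ _ _ _).trans (max_le ?_ ?_) <;> rw [abs_le] <;>
      push_cast <;> constructor <;> linarith
  | start v l =>
    have := edge (Nat.zero_le n) v l
    simp only [compPot, Fin.val_zero, leftPot] at this ⊢
    push_cast at *
    rw [abs_le] at *
    rw [min_def]
    split_ifs <;> constructor <;> linarith
  | leave i v l =>
    have := edge (i := i + 1) i.2 v l
    simp only [compPot, Fin.val_zero, Fin.val_succ, leftPot] at this ⊢
    push_cast at *
    rw [abs_le] at *
    rw [min_def]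
    split_ifs <;> constructor <;> linarith
  | enter i v v' l hv =>
    have := edge (i := i) i.2.le v l
    simp only [compPot, Fin.val_last, Fin.val_castSucc, rightPot, hv, if_neg i.2.ne] at this ⊢
    push_cast at *
    rw [abs_le] at *
    rw [min_def]
    split_ifs <;> constructor <;> linarith
  | finish v v' l hv =>
    have := edge le_rfl v l
    simp only [compPot, Fin.val_last, rightPot, hv, if_true] at this ⊢
    push_cast at *
    rw [abs_le] at *
    rw [min_def]
    split_ifs <;> constructor <;> linarith

theorem compRel_near_sub (i : Fin (n + 1)) (v : B) (l : L) (j : Fin (m + 1)) :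
    Near (g.CompRel a b n m B) j (.sub i v l 0) (.sub i v l j) := by
  induction j using Fin.induction with
  | zero => exact .refl _
  | succ j ih => exact ih.trans (.of_rel (.sub i v l j))

/-- Up to the entrance of copy `i` the path uses `i + 1` connecting edges of length `m + 2` and
crosses `i` copies. -/
theorem compRel_near_node (q : P) (s : Z) (hs : ∀ i ≤ n + 1, s + g.offset a b q i ∈ B)
    (i : ℕ) (hi : i < n) :
    Near (g.CompRel a b n m B) ((i + 1) * (m + 2) + i * D)
      (.hubIn ⟨s + g.offset a b q 0, hs 0 (Nat.zero_le _)⟩)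
      (.node ⟨i, hi⟩ ⟨s + g.offset a b q (i + 1), hs (i + 1) (by omega)⟩
        (g.port i (g.label q i))) := by
  induction i with
  | zero =>
    have h₁ := (Near.of_rel (CompRel.start (g := g) (a := a) (b := b) (m := m) (n := n)
      ⟨s + g.offset a b q 0, hs 0 (Nat.zero_le _)⟩ (g.label q 0))).trans
        (compRel_near_sub _ _ _ (Fin.last m))
    have h₂ := h₁.trans (Near.of_rel (CompRel.enter ⟨0, hi⟩ _
      ⟨s + g.offset a b q (0 + 1), hs (0 + 1) (by omega)⟩ _ (by simp [offset])))
    convert h₂ using 1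
    simp
    omega
  | succ i ih =>
    have h₁ := (ih (by omega)).trans ((g.near_port i q).map (fun x => CompVert.node (n := n) (B := B)
      ⟨i, by omega⟩ ⟨s + g.offset a b q (i + 1), hs (i + 1) (by omega)⟩ x)
      (fun x y h => CompRel.node (a := a) (b := b) (m := m) _ _ x y h))
    have h₂ := (h₁.trans (Near.of_rel (CompRel.leave (g := g) ⟨i, by omega⟩
      ⟨s + g.offset a b q (i + 1), hs (i + 1) (by omega)⟩ (g.label q (i + 1))))).trans
        (compRel_near_sub _ _ _ (Fin.last m))
    have h₃ := h₂.trans (Near.of_rel (CompRel.enter ⟨i + 1, hi⟩ _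
      ⟨s + g.offset a b q (i + 1 + 1), hs (i + 1 + 1) (by omega)⟩ _
      (by simp [offset, add_assoc])))
    convert h₃ using 1
    simp only [Fin.val_last]
    ring

theorem compRel_near (hn : 0 < n) (q : P) (s : Z)
    (hs : ∀ i ≤ n + 1, s + g.offset a b q i ∈ B) :
    Near (g.CompRel a b n m B) ((n + 1) * (m + 2) + n * D)
      (.hubIn ⟨s + g.offset a b q 0, hs 0 (Nat.zero_le _)⟩)
      (.hubOut ⟨s + g.offset a b q (n + 1), hs (n + 1) le_rfl⟩) := by
  obtain ⟨i, rfl⟩ : ∃ i, n = i + 1 := ⟨n - 1, by omega⟩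
  have h₁ := (compRel_near_node q s hs i (by omega)).trans ((g.near_port i q).map (fun x =>
    CompVert.node (n := i + 1) (B := B) ⟨i, by omega⟩ ⟨s + g.offset a b q (i + 1), hs (i + 1) (by omega)⟩ x)
    (fun x y h => CompRel.node (a := a) (b := b) (m := m) _ _ x y h))
  have h₂ := (h₁.trans (Near.of_rel (CompRel.leave (g := g) ⟨i, by omega⟩
      ⟨s + g.offset a b q (i + 1), hs (i + 1) (by omega)⟩ (g.label q (i + 1))))).trans
      (compRel_near_sub _ _ _ (Fin.last m))
  have h₃ := h₂.trans (Near.of_rel (CompRel.finish _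
    ⟨s + g.offset a b q (i + 1 + 1), hs (i + 1 + 1) (by omega)⟩ _
    (by simp [offset, add_assoc])))
  convert h₃ using 1
  simp only [Fin.val_last]
  ring

/-- Inside a copy the edge determines `p`; the position of the copy minus the offset of `p` then
determines the start `s`. -/
theorem compCrit_unique {S : Finset Z} {q r : S × P} {X Y : CompVert n m L V B}
    (h : g.CompCrit a b n m B S q X Y)
    (h' : g.CompCrit a b n m B S r X Y ∨ g.CompCrit a b n m B S r Y X) : q = r := by
  obtain ⟨⟨s, hs⟩, p⟩ := q
  obtain ⟨⟨s', hs'⟩, p'⟩ := r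
  obtain ⟨i, v, x, y, hv, rfl, rfl, hc⟩ := h
  simp only at hv hc
  have key : ∀ i' : Fin n, (i : ℕ) = i' → (v : Z) = s' + g.offset a b p' (i' + 1) →
      (g.crit p' x y ∨ g.crit p' y x) → (⟨⟨s, hs⟩, p⟩ : S × P) = ⟨⟨s', hs'⟩, p'⟩ := by
    intro i' hi hv' hc'
    obtain rfl := g.crit_unique _ _ _ _ hc hc'
    rw [hv, hi] at hv'
    obtain rfl := add_right_cancel hv'
    rfl
  rcases h' with ⟨i', v', x', y', hv', hx, hy, hc'⟩ | ⟨i', v', x', y', hv', hx, hy, hc'⟩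
  · cases hx
    cases hy
    exact key i rfl hv' (.inl hc')
  · cases hx
    cases hy
    exact key i rfl hv' (.inr hc')

/-- The composition of a gadget with itself along the lattice paths that start in `S` and proceed
with the step vectors `a` and `b` alternately. -/
noncomputable def comp (g : SpannerGadget D e L P V) (a b : L → Z) (n m : ℕ) (B S : Finset Z)
    (hn : 0 < n) (hw : n * e = m + 2) (hΦ : ∀ p, ∃ Φ, g.Exposes a b Φ p)
    (hS : ∀ s ∈ S, ∀ p, ∀ i ≤ n + 1, s + g.offset a b p i ∈ B) :
    SpannerGadget ((n + 1) * (n * e) + n * D) (n * e) B (S × P) (CompVert n m L V B) where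
  rel := g.CompRel a b n m B
  crit := g.CompCrit a b n m B S
  inp := .hubIn
  out := .hubOut
  src q := ⟨(q.1 : Z) + g.offset a b q.2 0, hS _ q.1.2 _ _ (Nat.zero_le _)⟩
  tgt q := ⟨(q.1 : Z) + g.offset a b q.2 (n + 1), hS _ q.1.2 _ _ le_rfl⟩
  crit_unique _ _ _ _ h h' := compCrit_unique h h'
  near q := by
    rw [hw]
    exact compRel_near hn q.2 (q.1 : Z) (hS _ q.1.2 _)
  level := g.compLevel n m B
  level_rel _ _ h := compLevel_rel h
  level_inp _ := rfl
  level_out _ := by rw [hw]; simp [compLevel]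
  pot q := g.compPot a b n m B (hΦ q.2).choose q.1 q.2
  pot_rel q _ _ h hc := compPot_rel hw (hΦ q.2).choose_spec h hc
  pot_src q := by simp [compPot, hubPot]
  pot_tgt q := by rw [hw]; simp [compPot, hubPot]
  pot_inp q v := by
    have := penalty_mem (m + 2) (hΦ q.2).choose (q.1 + g.offset a b q.2 0) (v : Z)
    rw [hw]
    simp only [compPot, hubPot]
    split_ifs
    · constructor <;> positivity
    · exact this
  pot_out q v := by
    have := penalty_mem (m + 2) (hΦ q.2).choose (q.1 + g.offset a b q.2 (n + 1)) (v : Z)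
    rw [hw]
    simp only [compPot, hubPot]
    push_cast at *
    split_ifs <;> constructor <;> linarith

theorem card_compVert {L V Z : Type} {n m : ℕ} {B : Finset Z} [Fintype L] [Fintype V] :
    Nat.card (CompVert n m L V B) =
      B.card * (2 + n * Fintype.card V + (n + 1) * Fintype.card L * (m + 1)) := by
  let f : CompVert n m L V B ≃ (B ⊕ B) ⊕ ((Fin n × B × V) ⊕ (Fin (n + 1) × B × L × Fin (m + 1))) :=
    { toFun := fun
        | .hubIn v => .inl (.inl v)
        | .hubOut v => .inl (.inr v)
        | .node i v x => .inr (.inl (i, v, x))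
        | .sub i v l j => .inr (.inr (i, v, l, j))
      invFun := fun
        | .inl (.inl v) => .hubIn v
        | .inl (.inr v) => .hubOut v
        | .inr (.inl (i, v, x)) => .node i v x
        | .inr (.inr (i, v, l, j)) => .sub i v l j
      left_inv := by rintro (_ | _ | _ | _) <;> rfl
      right_inv := by rintro ((_ | _) | (_ | _)) <;> rfl }
  rw [Nat.card_congr f, Nat.card_eq_fintype_card]
  simp only [Fintype.card_sum, Fintype.card_prod, Fintype.card_fin, Fintype.card_coe]
  ring

end SpannerGadget

/-! ### From gadgets to spanners, and the choice of lattice steps -/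

namespace SpannerGadget

/-- A function that changes by at most `1` along edges is a lower bound for distances. -/
theorem _root_.SimpleGraph.Walk.sub_le_length {U : Type} {H : SimpleGraph U} {f : U → ℤ}
    (hf : ∀ x y, H.Adj x y → |f x - f y| ≤ 1) {x y : U} (w : H.Walk x y) :
    f y - f x ≤ w.length := by
  induction w with
  | nil => simp
  | cons h w ih =>
    have := abs_le.1 (hf _ _ h)
    rw [SimpleGraph.Walk.length_cons]
    push_cast
    linarith

/-- Pigeonhole: otherwise choosing a surviving critical edge for each pair would inject the pairs
into the edges of `H`. -/
theorem exists_forall_crit_not_adj {D e : ℕ} {L P V U : Type} [Fintype P] [Finite U]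
    (g : SpannerGadget D e L P V) (f : V ↪ U) (H : SimpleGraph U)
    (hH : H.edgeSet.ncard < Fintype.card P) :
    ∃ p, ∀ x y, g.crit p x y → ¬ H.Adj (f x) (f y) := by
  classical
  have := Fintype.ofFinite U
  by_contra! hcon
  choose x y hc hadj using hcon
  refine hH.not_ge ?_
  rw [← Nat.card_eq_fintype_card, ← Nat.card_coe_set_eq]
  refine Nat.card_le_card_of_injective
    (fun p => (⟨s(f (x p), f (y p)), hadj p⟩ : H.edgeSet)) fun p q hpq => ?_
  replace hpq : s(f (x p), f (y p)) = s(f (x q), f (y q)) := congrArg Subtype.val hpq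
  simp only [Sym2.eq_iff, f.injective.eq_iff] at hpq
  refine g.crit_unique p q (x p) (y p) (hc p) ?_
  rcases hpq with ⟨h₁, h₂⟩ | ⟨h₁, h₂⟩
  · rw [h₁, h₂]
    exact .inl (hc q)
  · rw [h₁, h₂]
    exact .inr (hc q)

/-- A spanner construction with fewer edges than a gadget has pairs loses all the critical edges
of some pair. -/
theorem le_of_isSpannerConstruction {D e : ℕ} {L P V : Type} [Fintype P] [Fintype V]
    (g : SpannerGadget D e L P V) {n : ℕ} (hV : Fintype.card V ≤ n) {ε β s : ℝ} (hε : 0 ≤ ε)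
    (hs : s < Fintype.card P) {A : SimpleGraph (Fin n) → SimpleGraph (Fin n)}
    (hA : IsSpannerConstruction n (1 + ε) β s A) : 2 * (e : ℝ) ≤ ε * D + β := by
  classical
  obtain ⟨f⟩ : Nonempty (V ↪ Fin n) :=
    Function.Embedding.nonempty_of_card_le (by simpa using hV)
  set G := (SimpleGraph.fromRel g.rel).map f with hG
  obtain ⟨⟨hle, hdist⟩, hcard⟩ := hA G
  obtain ⟨p, hp⟩ := g.exists_forall_crit_not_adj f (A G) (by exact_mod_cast hcard.trans_lt hs)
  obtain ⟨w, hw⟩ := g.near p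
  let w' := w.map (SimpleGraph.Embedding.map f (SimpleGraph.fromRel g.rel)).toHom
  obtain ⟨hreach, hst⟩ : (A G).Reachable (f (g.inp (g.src p))) (f (g.out (g.tgt p))) ∧
      ((A G).dist (f (g.inp (g.src p))) (f (g.out (g.tgt p))) : ℝ) ≤
        (1 + ε) * (G.dist (f (g.inp (g.src p))) (f (g.out (g.tgt p))) : ℝ) + β := hdist _ _ ⟨w'⟩
  obtain ⟨w₂, hw₂⟩ := hreach.exists_walk_length_eq_dist
  have hD : G.dist (f (g.inp (g.src p))) (f (g.out (g.tgt p))) ≤ D := by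
    have h : G.dist (f (g.inp (g.src p))) (f (g.out (g.tgt p))) ≤ w'.length :=
      SimpleGraph.dist_le w'
    rw [SimpleGraph.Walk.length_map] at h
    exact h.trans hw
  have : Nonempty V := ⟨g.inp (g.src p)⟩
  have hinv : ∀ x, Function.invFun f (f x) = x := Function.leftInverse_invFun f.injective
  have hpot : ∀ u v, (A G).Adj u v →
      |g.pot p (Function.invFun f u) - g.pot p (Function.invFun f v)| ≤ 1 := by
    intro u v huv
    obtain ⟨x, y, hxy, rfl, rfl⟩ := (SimpleGraph.map_adj _ _ _ _).1 (hle huv)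
    rw [hinv, hinv]
    rcases ((SimpleGraph.fromRel_adj _ _ _).1 hxy).2 with h | h
    · exact g.pot_rel p x y h fun hc => hp x y hc huv
    · rw [abs_sub_comm]
      exact g.pot_rel p y x h fun hc => hp y x hc huv.symm
  have hE := w₂.sub_le_length hpot
  rw [hinv, hinv, g.pot_src, g.pot_tgt, sub_zero, hw₂] at hE
  have hE' : (D : ℝ) + 2 * e ≤ (A G).dist (f (g.inp (g.src p))) (f (g.out (g.tgt p))) := by
    exact_mod_cast hE
  have hD' : (1 + ε) * (G.dist (f (g.inp (g.src p))) (f (g.out (g.tgt p))) : ℝ) ≤ (1 + ε) * D := by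
    gcongr
  linarith

/-! The step vectors are points of a paraboloid. -/

/-- The point over `x` of the paraboloid. -/
def paraboloid {d : ℕ} (x : Fin d → ℤ) : (Fin d → ℤ) × ℤ := (x, ∑ j, x j ^ 2)

/-- The functional that exposes `paraboloid x` among the points of the paraboloid. -/
def support {d : ℕ} (x : Fin d → ℤ) : (Fin d → ℤ) × ℤ →+ ℤ where
  toFun z := ∑ j, 2 * x j * z.1 j - z.2
  map_zero' := by simp
  map_add' z z' := by
    simp only [Prod.fst_add, Prod.snd_add, Pi.add_apply, mul_add, Finset.sum_add_distrib]
    ring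

/-- The difference of the two values is the squared Euclidean distance of `x` and `y`. -/
theorem support_lt {d : ℕ} {x y : Fin d → ℤ} (h : y ≠ x) :
    support x (paraboloid y) < support x (paraboloid x) := by
  have hsum : support x (paraboloid x) - support x (paraboloid y) = ∑ j, (x j - y j) ^ 2 := by
    simp only [support, paraboloid, AddMonoidHom.coe_mk, ZeroHom.coe_mk, ← Finset.sum_sub_distrib]
    exact Finset.sum_congr rfl fun j _ => by ring
  have hpos : 0 < ∑ j, (x j - y j) ^ 2 := by
    obtain ⟨j, hj⟩ := Function.ne_iff.1 h
    exact Finset.sum_pos' (fun _ _ => sq_nonneg _)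
      ⟨j, Finset.mem_univ _, by have := sub_ne_zero.2 hj.symm; positivity⟩
  linarith

variable {D e : ℕ} {L P V : Type} (g : SpannerGadget D e L P V)

/-- The vectors `a` and `b` live in complementary summands, so source and target are exposed
independently by one functional. -/
theorem exists_exposes {d : ℕ} {c : L → Fin d → ℤ} (hc : Function.Injective c) (p : P) :
    ∃ Φ, g.Exposes (fun l => (paraboloid (c l), 0)) (fun l => (0, paraboloid (c l))) Φ p := by
  refine ⟨(support (c (g.src p))).coprod (support (c (g.tgt p))), fun l hl => ?_, fun l hl => ?_⟩
  · simpa using support_lt (hc.ne hl)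
  · simpa using support_lt (hc.ne hl)

theorem offset_mem_Icc {Z : Type} [AddCommGroup Z] [PartialOrder Z] [IsOrderedAddMonoid Z]
    {a b : L → Z} {u : Z} (ha : ∀ l, a l ∈ Set.Icc 0 u) (hb : ∀ l, b l ∈ Set.Icc 0 u) (p : P)
    (i : ℕ) : g.offset a b p i ∈ Set.Icc 0 (i • u) := by
  induction i with
  | zero => simp [offset]
  | succ i ih =>
    have hs : step a b i (g.label p i) ∈ Set.Icc 0 u := by
      unfold step
      split_ifs
      · exact ha _
      · exact hb _
    rw [offset, succ_nsmul]
    exact ⟨add_nonneg ih.1 hs.1, add_le_add ih.2 hs.2⟩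

/-! ### Counting positions in boxes -/

/-- A bound for the points `paraboloid x` with `0 ≤ x j ≤ r`. -/
def corner (d r : ℕ) : (Fin d → ℤ) × ℤ := (fun _ => r, d * r ^ 2)

theorem corner_nonneg (d r : ℕ) : 0 ≤ corner d r :=
  Prod.le_def.2 ⟨fun _ => by simp [corner], by simp only [corner]; positivity⟩

open Classical in
/-- The box of positions between `0` and `t` times the largest step vectors. -/
noncomputable def box (d r t : ℕ) : Finset (((Fin d → ℤ) × ℤ) × ((Fin d → ℤ) × ℤ)) :=
  Finset.Icc 0 (t • (corner d r, corner d r))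

theorem mem_box {d r t : ℕ} {z : ((Fin d → ℤ) × ℤ) × ((Fin d → ℤ) × ℤ)} :
    z ∈ box d r t ↔ 0 ≤ z ∧ z ≤ t • (corner d r, corner d r) := by
  classical
  exact Finset.mem_Icc

theorem card_box (d r t : ℕ) :
    (box d r t).card = ((t * r + 1) ^ d * (t * (d * r ^ 2) + 1)) ^ 2 := by
  have h₁ : ((t : ℤ) * r + 1).toNat = t * r + 1 := by norm_cast
  have h₂ : ((t : ℤ) * (d * r ^ 2) + 1).toNat = t * (d * r ^ 2) + 1 := by norm_cast
  classical
  rw [box, Finset.card_Icc_prod, Finset.card_Icc_prod, Finset.card_Icc_prod]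
  simp [Pi.card_Icc, corner, h₁, h₂]
  ring

theorem paraboloid_nonneg {d : ℕ} {x : Fin d → ℤ} (hx : ∀ j, 0 ≤ x j) : 0 ≤ paraboloid x :=
  Prod.le_def.2 ⟨hx, show 0 ≤ ∑ j, x j ^ 2 from Finset.sum_nonneg fun _ _ => sq_nonneg _⟩

theorem paraboloid_le_corner {d r : ℕ} {x : Fin d → ℤ} (h₀ : ∀ j, 0 ≤ x j) (hx : ∀ j, x j ≤ r) :
    paraboloid x ≤ corner d r := by
  refine Prod.le_def.2 ⟨hx, ?_⟩
  have : ∀ j ∈ Finset.univ, x j ^ 2 ≤ (r : ℤ) ^ 2 := fun j _ => pow_le_pow_left₀ (h₀ j) (hx j) 2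
  simpa [paraboloid, corner] using Finset.sum_le_sum this

/-- The composition along the lattice paths with steps on the paraboloid. -/
theorem nonempty_comp [Fintype L] (g : SpannerGadget D e L P V) {d r n m : ℕ} (hn : 0 < n) (hm : n * e = m + 2)
    (hL : Fintype.card L ≤ r ^ d) :
    Nonempty (SpannerGadget ((n + 1) * (n * e) + n * D) (n * e) (box d r (n + 2))
      (box d r 1 × P) (CompVert n m L V (box d r (n + 2)))) := by
  obtain ⟨f⟩ : Nonempty (L ↪ (Fin d → Fin r)) :=
    Function.Embedding.nonempty_of_card_le (by simpa using hL)
  let c : L → Fin d → ℤ := fun l j => (f l j : ℕ)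
  have hc : Function.Injective c := fun l l' hl =>
    f.injective (funext fun j => Fin.ext (Int.ofNat_inj.1 (congrFun hl j)))
  have h₀ : ∀ l, 0 ≤ paraboloid (c l) := fun l => paraboloid_nonneg fun j => Int.natCast_nonneg _
  have h₁ : ∀ l, paraboloid (c l) ≤ corner d r := fun l =>
    paraboloid_le_corner (fun j => Int.natCast_nonneg _) fun j => Int.ofNat_le.2 (f l j).2.le
  have hu := corner_nonneg d r
  refine ⟨g.comp (fun l => (paraboloid (c l), 0)) (fun l => (0, paraboloid (c l))) n m _ _ hn hm
    (g.exists_exposes hc) fun s hs p i hi => ?_⟩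
  rw [mem_box, one_smul] at hs
  have ho := g.offset_mem_Icc (a := fun l => (paraboloid (c l), 0))
    (b := fun l => (0, paraboloid (c l))) (u := (corner d r, corner d r))
    (fun l => ⟨Prod.le_def.2 ⟨h₀ l, le_rfl⟩, Prod.le_def.2 ⟨h₁ l, hu⟩⟩)
    (fun l => ⟨Prod.le_def.2 ⟨le_rfl, h₀ l⟩, Prod.le_def.2 ⟨hu, h₁ l⟩⟩) p i
  refine mem_box.2 ⟨add_nonneg hs.1 ho.1, (add_le_add hs.2 ho.2).trans ?_⟩
  -- The start accounts for one multiple of the corner and the at most `n + 1` steps for the rest of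
  -- `n + 2`.
  rw [← succ_nsmul']
  exact nsmul_le_nsmul_left (hs.1.trans hs.2) (by omega)

/-- In each of the two summands, `d` coordinates range over order `r` and one over order `r ^ 2`,
whence the exponent `2 * (d + 2)`. `le_card_box_one` has the same power of `r`, so restricting the
starts costs only a constant factor. -/
theorem card_box_le {d r : ℕ} (hd : 0 < d) (hr : 0 < r) (n : ℕ) :
    (box d r (n + 2)).card ≤ ((n + 3) ^ (d + 1) * d) ^ 2 * r ^ (2 * d + 4) := by
  have h : ((n + 2) * r + 1) ^ d * ((n + 2) * (d * r ^ 2) + 1) ≤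
      ((n + 3) * r) ^ d * ((n + 3) * (d * r ^ 2)) := by
    have : 0 < d * r ^ 2 := by positivity
    gcongr <;> nlinarith
  rw [card_box]
  refine (Nat.pow_le_pow_left h 2).trans_eq ?_
  rw [mul_pow (n + 3) r d]
  ring

theorem le_card_box_one {d : ℕ} (hd : 0 < d) (r : ℕ) : r ^ (2 * d + 4) ≤ (box d r 1).card := by
  rw [card_box]
  calc r ^ (2 * d + 4) = ((1 * r) ^ d * (1 * (1 * r ^ 2))) ^ 2 := by ring
    _ ≤ ((1 * r + 1) ^ d * (1 * (d * r ^ 2))) ^ 2 := by gcongr <;> omega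
    _ ≤ _ := by gcongr; omega

/-- There is a gadget with at most `l` labels, at least `p` pairs and at most `v` vertices. -/
def _root_.HasGadget (D e : ℕ) (l p v : ℝ) : Prop :=
  ∃ (L P V : Type) (_ : Fintype L) (_ : Fintype P) (_ : Fintype V),
    Nonempty (SpannerGadget D e L P V) ∧
      (Fintype.card L : ℝ) ≤ l ∧ p ≤ Fintype.card P ∧ (Fintype.card V : ℝ) ≤ v

theorem _root_.HasGadget.comp {d r n : ℕ} {p v : ℝ} (hd : 0 < d) (hr : 0 < r) (hn : 0 < n)
    (hne : 2 ≤ n * e) (hp : 0 ≤ p) (h : HasGadget D e ((r : ℝ) ^ d) p v) :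
    HasGadget ((n + 1) * (n * e) + n * D) (n * e)
      (((n + 3 : ℝ) ^ (d + 1) * d) ^ 2 * r ^ (2 * d + 4)) (r ^ (2 * d + 4) * p)
      ((((n + 3 : ℝ) ^ (d + 1) * d) ^ 2 * r ^ (2 * d + 4)) *
        (2 + n * v + (n + 1) * (n * e) * r ^ d)) := by
  obtain ⟨L, P, V, _, _, _, ⟨g⟩, hL, hP, hV⟩ := h
  obtain ⟨m, hm⟩ : ∃ m, n * e = m + 2 := ⟨n * e - 2, by omega⟩
  obtain ⟨g'⟩ := g.nonempty_comp hn hm (d := d) (r := r) (by exact_mod_cast hL)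
  have hB : ((box d r (n + 2)).card : ℝ) ≤ ((n + 3 : ℝ) ^ (d + 1) * d) ^ 2 * r ^ (2 * d + 4) := by
    exact_mod_cast card_box_le hd hr n
  have hS : (r : ℝ) ^ (2 * d + 4) ≤ (box d r 1).card := by exact_mod_cast le_card_box_one hd r
  have hcard := card_compVert (n := n) (m := m) (L := L) (V := V) (B := box d r (n + 2))
  have : Finite (CompVert n m L V (box d r (n + 2))) := by
    apply Nat.finite_of_card_ne_zero
    rw [hcard, card_box]
    positivity
  have := Fintype.ofFinite (CompVert n m L V (box d r (n + 2)))
  refine ⟨box d r (n + 2), box d r 1 × P, CompVert n m L V (box d r (n + 2)), inferInstance,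
    inferInstance, inferInstance, ⟨g'⟩, by rwa [Fintype.card_coe], ?_, ?_⟩
  · rw [Fintype.card_prod, Fintype.card_coe]
    push_cast
    gcongr
  · rw [← Nat.card_eq_fintype_card, hcard]
    have hm' : (m : ℝ) + 1 ≤ n * e := by
      have : (n : ℝ) * e = m + 2 := by exact_mod_cast hm
      linarith
    push_cast
    have h₁ : ((n : ℝ) + 1) * Fintype.card L * (m + 1) ≤ (n + 1) * (n * e) * r ^ d := by
      calc ((n : ℝ) + 1) * Fintype.card L * (m + 1) ≤ (n + 1) * r ^ d * (n * e) := by gcongr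
        _ = _ := by ring
    gcongr

theorem _root_.HasGadget.mono {l l' p p' v v' : ℝ} (h : HasGadget D e l p v) (hl : l ≤ l')
    (hp : p' ≤ p) (hv : v ≤ v') : HasGadget D e l' p' v' := by
  obtain ⟨L, P, V, _, _, _, hg, hL, hP, hV⟩ := h
  exact ⟨L, P, V, _, _, _, hg, hL.trans hl, hp.trans hP, hV.trans hv⟩

theorem _root_.hasGadget_biclique (N : ℕ) : HasGadget 1 1 N ((N : ℝ) ^ 2) (2 * N) :=
  ⟨Fin N, Fin N × Fin N, Fin N ⊕ Fin N, inferInstance, inferInstance, inferInstance,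
    ⟨biclique (Fin N)⟩, by simp, by simp [sq], by simp [two_mul]⟩

end SpannerGadget

/-! ### Asymptotic sizes -/

open Filter

theorem eventually_mul_rpow_le_rpow (c : ℝ) {x y : ℝ} (h : x < y) :
    ∀ᶠ t : ℝ in atTop, c * t ^ x ≤ t ^ y := by
  filter_upwards [(tendsto_rpow_atTop (sub_pos.2 h)).eventually_ge_atTop c,
    eventually_gt_atTop 0] with t ht ht0
  calc c * t ^ x ≤ t ^ (y - x) * t ^ x := by gcongr
    _ = t ^ y := by rw [← Real.rpow_add ht0, sub_add_cancel]

theorem tendsto_floor_rpow {C θ : ℝ} (hC : 0 < C) (hθ : 0 < θ) :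
    Tendsto (fun N : ℕ => ⌊((N : ℝ) / C) ^ θ⌋₊) atTop atTop :=
  tendsto_nat_floor_atTop.comp ((tendsto_rpow_atTop hθ).comp
    (tendsto_natCast_atTop_atTop.atTop_div_const hC))

/-- For each `η > 0` there are, for all large `N`, gadgets with at most `N` labels, at least
`N ^ (2 - η)` pairs and at most `N ^ (2 - 2⁻ʲ + η)` vertices. -/
theorem eventually_hasGadget {n : ℕ} (hn : 2 ≤ n) (j : ℕ) :
    ∀ η : ℝ, 0 < η → η ≤ 1 → ∀ᶠ N : ℕ in atTop,
      HasGadget (n ^ j * (1 + j * (n + 1))) (n ^ j) N ((N : ℝ) ^ (2 - η))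
        ((N : ℝ) ^ (2 - (1 / 2 : ℝ) ^ j + η)) := by
  induction j with
  | zero =>
    intro η hη _
    filter_upwards [tendsto_natCast_atTop_atTop.eventually
      (eventually_mul_rpow_le_rpow 2 (show (1 : ℝ) < 2 - (1 / 2) ^ 0 + η by simp; linarith)),
      eventually_ge_atTop 1] with N hN hN1
    have hN1' : (1 : ℝ) ≤ N := by exact_mod_cast hN1
    have h := (hasGadget_biclique N).mono le_rfl
      (p' := (N : ℝ) ^ (2 - η)) (v' := (N : ℝ) ^ (2 - (1 / 2 : ℝ) ^ 0 + η)) ?_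
      (by simpa using hN)
    · simpa using h
    · rw [← Real.rpow_natCast]
      exact Real.rpow_le_rpow_of_exponent_le hN1' (by push_cast; linarith)
  | succ j ih =>
    intro η hη hη1
    -- The `r ^ d` labels of the inner gadget compare with about `r ^ (2 * d + 4)` positions; a
    -- large `d` brings the ratio of exponents within `η / 8` of `1 / 2`.
    obtain ⟨d, hd⟩ := exists_nat_gt (8 / η)
    have hd0 : 0 < d := by
      have : (0 : ℝ) < d := (by positivity : 0 < 8 / η).trans hd
      exact_mod_cast this
    have hdη : 8 ≤ η * d := by
      rw [div_lt_iff₀ hη] at hd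
      linarith
    set M : ℕ := 2 * d + 4 with hM
    have hM0 : (0 : ℝ) < M := by rw [hM]; positivity
    have hM' : (M : ℝ) = 2 * d + 4 := by rw [hM]; push_cast; ring
    set C : ℝ := ((n + 3 : ℝ) ^ (d + 1) * d) ^ 2 with hC
    have hC0 : 0 < C := by rw [hC]; positivity
    have hC1 : 1 ≤ C := by
      have h₁ : (1 : ℝ) ≤ (n + 3) ^ (d + 1) := one_le_pow₀ (by linarith [Nat.cast_nonneg (α := ℝ) n])
      have h₂ : (1 : ℝ) ≤ d := by exact_mod_cast hd0
      exact one_le_pow₀ (one_le_mul_of_one_le_of_one_le h₁ h₂)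
    set F : ℝ := 2 - (1 / 2 : ℝ) ^ j with hF
    have hF1 : 1 ≤ F := by
      have : (1 / 2 : ℝ) ^ j ≤ 1 := pow_le_one₀ (by norm_num) (by norm_num)
      linarith
    have hF' : 2 - (1 / 2 : ℝ) ^ (j + 1) = 1 + F / 2 := by rw [hF, pow_succ]; ring
    set K : ℝ := 2 + n + (n + 1) * (n * (n ^ j : ℕ)) with hK
    have hr := tendsto_floor_rpow hC0 (one_div_pos.2 hM0)
    have hlim : Tendsto (fun N : ℕ => ⌊((N : ℝ) / C) ^ (1 / (M : ℝ))⌋₊ ^ d) atTop atTop :=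
      (tendsto_pow_atTop hd0.ne').comp hr
    filter_upwards [hlim.eventually (ih (η / 2) (by linarith) (by linarith)),
      hr.eventually_ge_atTop 1, eventually_ge_atTop 1,
      tendsto_natCast_atTop_atTop.eventually (eventually_mul_rpow_le_rpow
        ((2 ^ M * C) ^ (2 - η / 2)) (show 2 - η < 2 - η / 2 by linarith)),
      tendsto_natCast_atTop_atTop.eventually (eventually_mul_rpow_le_rpow K
        (show 1 + F / 2 + η / 2 < 1 + F / 2 + η by linarith)),
      tendsto_natCast_atTop_atTop.eventually_ge_atTop C] with N hg hr1 hN1 hpairs hverts hNC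
    set r := ⌊((N : ℝ) / C) ^ (1 / (M : ℝ))⌋₊ with hrdef
    have hN0 : (0 : ℝ) < N := by exact_mod_cast hN1
    have hN1' : (1 : ℝ) ≤ N := by exact_mod_cast hN1
    have hr1' : (1 : ℝ) ≤ r := by exact_mod_cast hr1
    have hr0 : (0 : ℝ) < r := by linarith
    have hroot : (((N : ℝ) / C) ^ (1 / (M : ℝ))) ^ M = N / C := by
      rw [← Real.rpow_natCast, ← Real.rpow_mul (by positivity), one_div_mul_cancel hM0.ne',
        Real.rpow_one]
    have hup : (r : ℝ) ^ M ≤ N / C := by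
      rw [← hroot]
      gcongr
      exact Nat.floor_le (by positivity)
    have hlow : N / C ≤ 2 ^ M * (r : ℝ) ^ M := by
      rw [← hroot, ← mul_pow]
      gcongr
      have := (Nat.lt_floor_add_one (((N : ℝ) / C) ^ (1 / (M : ℝ)))).le
      rw [← hrdef] at this
      linarith
    have hCN : C * (r : ℝ) ^ M ≤ N := by
      rw [le_div_iff₀ hC0] at hup
      linarith
    have hrM1 : (1 : ℝ) ≤ (r : ℝ) ^ M := one_le_pow₀ hr1'
    have hrd1 : (1 : ℝ) ≤ (r : ℝ) ^ d := one_le_pow₀ hr1'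
    have hrd : ∀ x : ℝ, ((r : ℝ) ^ d) ^ x = ((r : ℝ) ^ M) ^ (d / M * x) := by
      intro x
      rw [← Real.rpow_natCast, ← Real.rpow_natCast, ← Real.rpow_mul hr0.le, ← Real.rpow_mul hr0.le]
      congr 1
      field_simp
    have hratio : (d : ℝ) / M ≤ 1 / 2 := by
      rw [div_le_div_iff₀ hM0 two_pos, hM']
      linarith
    have hratio' : 1 / 2 - η / 8 ≤ (d : ℝ) / M := by
      rw [le_div_iff₀ hM0, hM']
      nlinarith
    have hg' : HasGadget (n ^ j * (1 + j * (n + 1))) (n ^ j) ((r : ℝ) ^ d)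
        (((r : ℝ) ^ d) ^ (2 - η / 2)) (((r : ℝ) ^ d) ^ (F + η / 2)) := by simpa using hg
    have hne : 2 ≤ n * n ^ j := hn.trans (Nat.le_mul_of_pos_right _ (by positivity))
    have h := hg'.comp hd0 hr1 (n := n) (by omega) hne (by positivity)
    -- The recursion for `D` is solved by the closed form, each composition adding `n + 1` to the
    -- ratio `D / e`.
    have hD : (n + 1) * (n * n ^ j) + n * (n ^ j * (1 + j * (n + 1))) =
        n ^ (j + 1) * (1 + (j + 1) * (n + 1)) := by ring
    rw [hD, ← pow_succ'] at h
    refine h.mono hCN ?_ ?_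
    · have hexp : 2 - η / 2 ≤ 1 + d / M * (2 - η / 2) := by
        have h₁ := mul_le_mul_of_nonneg_right hratio' (show 0 ≤ 2 - η / 2 by linarith)
        have h₂ : (1 / 2 - η / 8) * (2 - η / 2) = 1 - η / 2 + η ^ 2 / 16 := by ring
        have h₃ := sq_nonneg η
        linarith
      have h₁ : (N : ℝ) ^ (2 - η / 2) ≤ (2 ^ M * C) ^ (2 - η / 2) * ((r : ℝ) ^ M) ^ (2 - η / 2) := by
        rw [← Real.mul_rpow (by positivity) (by positivity)]
        refine Real.rpow_le_rpow hN0.le ?_ (by linarith)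
        rw [div_le_iff₀ hC0] at hlow
        linarith
      have h₂ : (N : ℝ) ^ (2 - η) ≤ ((r : ℝ) ^ M) ^ (2 - η / 2) :=
        le_of_mul_le_mul_left (hpairs.trans h₁) (by positivity)
      refine h₂.trans ((Real.rpow_le_rpow_of_exponent_le hrM1 hexp).trans_eq ?_)
      rw [Real.rpow_add (by positivity), Real.rpow_one, hrd]
    · set X := ((r : ℝ) ^ d) ^ (F + η / 2) with hX
      have hX1 : (r : ℝ) ^ d ≤ X := by
        simpa using Real.rpow_le_rpow_of_exponent_le hrd1 (show (1 : ℝ) ≤ F + η / 2 by linarith)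
      have hrN : (r : ℝ) ^ M ≤ N := le_trans (le_mul_of_one_le_left (by positivity) hC1) hCN
      have hXN : X ≤ (N : ℝ) ^ (F / 2 + η / 2) := by
        rw [hX, hrd]
        refine (Real.rpow_le_rpow (by positivity) hrN (by positivity)).trans
          (Real.rpow_le_rpow_of_exponent_le hN1' ?_)
        have := mul_le_mul_of_nonneg_right hratio (show 0 ≤ F + η / 2 by linarith)
        linarith
      have hK' : 2 + n * X + (n + 1) * (n * (n ^ j : ℕ)) * (r : ℝ) ^ d ≤ K * X := by
        have h₁ : (n + 1 : ℝ) * (n * (n ^ j : ℕ)) * (r : ℝ) ^ d ≤ (n + 1) * (n * (n ^ j : ℕ)) * X := by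
          gcongr
        rw [hK]
        linarith
      rw [hF']
      refine le_trans ?_ hverts
      calc C * (r : ℝ) ^ M * (2 + n * X + (n + 1) * (n * (n ^ j : ℕ)) * (r : ℝ) ^ d)
          ≤ N * (K * (N : ℝ) ^ (F / 2 + η / 2)) := by
            refine mul_le_mul hCN (hK'.trans ?_) (by positivity) hN0.le
            gcongr
        _ = K * ((N : ℝ) ^ (1 : ℝ) * (N : ℝ) ^ (F / 2 + η / 2)) := by rw [Real.rpow_one]; ring
        _ = K * (N : ℝ) ^ (1 + F / 2 + η / 2) := by rw [← Real.rpow_add hN0, add_assoc]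

/-- A gadget of label size `r`, about `N ^ (1 / (F + η))`, fits into `N` vertices and has about `N ^
((2 - η) / (F + η))` pairs. For small `η` this exceeds the allowed number of edges. -/
theorem eventually_forall_two_mul_pow_le {n : ℕ} (hn : 2 ≤ n) (j : ℕ) {δ : ℝ} (hδ : 0 < δ) :
    ∀ᶠ N : ℕ in atTop, ∀ (ε β : ℝ) (A : SimpleGraph (Fin N) → SimpleGraph (Fin N)), 0 ≤ ε →
      IsSpannerConstruction N (1 + ε) β
        ((N : ℝ) ^ (2 / (2 - (1 / 2 : ℝ) ^ j) - δ)) A →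
      2 * (n : ℝ) ^ j ≤ ε * (n ^ j * (1 + j * (n + 1))) + β := by
  set F : ℝ := 2 - (1 / 2 : ℝ) ^ j with hF
  have hF1 : 1 ≤ F := by
    have : (1 / 2 : ℝ) ^ j ≤ 1 := pow_le_one₀ (by norm_num) (by norm_num)
    linarith
  have hF2 : F ≤ 2 := by
    have : 0 < (1 / 2 : ℝ) ^ j := by positivity
    linarith
  obtain ⟨η, hη, hη1, hηδ⟩ : ∃ η : ℝ, 0 < η ∧ η ≤ 1 ∧ η * 8 ≤ δ :=
    ⟨min 1 (δ / 8), by positivity, min_le_left _ _, by linarith [min_le_right 1 (δ / 8)]⟩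
  have hexp : 2 / F - δ < (2 - η) / (F + η) := by
    rw [div_sub' (by linarith), div_lt_div_iff₀ (by linarith) (by linarith)]
    nlinarith [mul_pos hη hη, mul_pos hδ hη, mul_le_mul hF1 hF1 zero_le_one (by linarith)]
  have hr := tendsto_floor_rpow one_pos (show 0 < 1 / (F + η) by positivity)
  filter_upwards [hr.eventually (eventually_hasGadget hn j η hη hη1),
    hr.eventually_ge_atTop 1, eventually_ge_atTop 1,
    tendsto_natCast_atTop_atTop.eventually (eventually_mul_rpow_le_rpow
      (2 * 2 ^ (2 - η)) hexp)] with N hg hr1 hN1 hN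
  intro ε β A hε hA
  rw [div_one] at hg hr1
  set r := ⌊(N : ℝ) ^ (1 / (F + η))⌋₊ with hrdef
  have hN0 : (0 : ℝ) < N := by exact_mod_cast hN1
  have hr1' : (1 : ℝ) ≤ r := by exact_mod_cast hr1
  obtain ⟨L, P, V, _, _, _, ⟨g⟩, -, hP, hV⟩ := hg
  have hVN : Fintype.card V ≤ N := by
    have : (r : ℝ) ^ (F + η) ≤ N := by
      calc (r : ℝ) ^ (F + η) ≤ ((N : ℝ) ^ (1 / (F + η))) ^ (F + η) :=
            Real.rpow_le_rpow (by positivity) (Nat.floor_le (by positivity)) (by positivity)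
        _ = N := by
          rw [← Real.rpow_mul hN0.le, one_div_mul_cancel (by positivity), Real.rpow_one]
    exact_mod_cast hV.trans this
  have hPN : (N : ℝ) ^ (2 / F - δ) < Fintype.card P := by
    refine lt_of_lt_of_le ?_ hP
    have h₁ : (N : ℝ) ^ ((2 - η) / (F + η)) ≤ 2 ^ (2 - η) * (r : ℝ) ^ (2 - η) := by
      rw [← Real.mul_rpow (by norm_num) (by positivity), div_eq_mul_one_div, mul_comm (2 - η),
        Real.rpow_mul hN0.le]
      refine Real.rpow_le_rpow (by positivity) ?_ (by linarith)
      have := (Nat.lt_floor_add_one ((N : ℝ) ^ (1 / (F + η)))).le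
      rw [← hrdef] at this
      linarith
    have h₂ : 2 * (N : ℝ) ^ (2 / F - δ) ≤ (r : ℝ) ^ (2 - η) := by
      refine le_of_mul_le_mul_left (a := (2 : ℝ) ^ (2 - η)) ?_ (by positivity)
      linarith
    have : 0 < (N : ℝ) ^ (2 / F - δ) := by positivity
    linarith
  have := g.le_of_isSpannerConstruction hVN hε hPN hA
  push_cast at this
  exact this

/-! ### The choice of parameters -/

theorem exponent_eq {k : ℕ} (hk : 1 ≤ k) :
    1 + 1 / ((2 : ℝ) ^ k - 1) = 2 / (2 - (1 / 2 : ℝ) ^ (k - 1)) := by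
  obtain ⟨j, rfl⟩ : ∃ j, k = j + 1 := ⟨k - 1, by omega⟩
  have h : (1 : ℝ) ≤ 2 ^ j := one_le_pow₀ (by norm_num)
  have h₁ : (2 : ℝ) ^ (j + 1) - 1 ≠ 0 := by rw [pow_succ]; linarith
  have h₂ : (2 : ℝ) - 1 / 2 ^ j ≠ 0 := by
    have : 1 / (2 : ℝ) ^ j ≤ 1 := by rw [div_le_one (by positivity)]; exact h
    linarith
  rw [Nat.add_sub_cancel, one_div_pow, pow_succ] at *
  field_simp
  ring

theorem mainTheorem3 :
    ∃ c : ℝ, 0 < c ∧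
      ∀ k : ℕ, 2 ≤ k → ∀ ε : ℝ, 0 < ε → ε ≤ 1 → ∀ δ : ℝ, 0 < δ →
        ∀ᶠ n : ℕ in Filter.atTop,
          ∀ (β : ℝ) (A : SimpleGraph (Fin n) → SimpleGraph (Fin n)),
            IsSpannerConstruction n (1 + ε) β
                ((n : ℝ) ^ (1 + 1 / ((2 : ℝ) ^ k - 1) - δ)) A →
              (c * (1 / (ε * ((k : ℝ) - 1)))) ^ (k - 1) ≤ β ∧
              (ε * ((k : ℝ) - 1) ≤ c → c * (1 / (ε * ((k : ℝ) - 1))) ^ (k - 1) ≤ β) := by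
  refine ⟨1 / 4, by norm_num, fun k hk ε hε hε1 δ hδ => ?_⟩
  have hk1 : (1 : ℝ) ≤ (k : ℝ) - 1 := by
    have : (2 : ℝ) ≤ k := by exact_mod_cast hk
    linarith
  have hcast : ((k - 1 : ℕ) : ℝ) = (k : ℝ) - 1 := by rw [Nat.cast_sub (by omega), Nat.cast_one]
  have hεk : 0 < ε * ((k : ℝ) - 1) := by positivity
  set x := 1 / (ε * ((k : ℝ) - 1)) with hx
  have hx0 : 0 < x := by positivity
  by_cases hsmall : ε * ((k : ℝ) - 1) ≤ 1 / 4
  · have hx4 : 4 ≤ x := by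
      rw [hx, le_div_iff₀ hεk]
      linarith
    have hxε : ε * ((k : ℝ) - 1) * x = 1 := mul_one_div_cancel hεk.ne'
    -- With `l + 1` the integer part of `3 / 2 * x`, the loss `ε * (k - 1) * (l + 1)` is at most `3
    -- / 2`, leaving a factor `2 - 1 / 4 - 3 / 2 = 1 / 4`, and still `l ≥ x` because `x ≥ 4`.
    obtain ⟨l, hl⟩ : ∃ l, ⌊3 / 2 * x⌋₊ = l + 1 :=
      ⟨⌊3 / 2 * x⌋₊ - 1, by
        have : 1 ≤ ⌊3 / 2 * x⌋₊ := Nat.le_floor (by push_cast; linarith)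
        omega⟩
    have hup : (l : ℝ) + 1 ≤ 3 / 2 * x := by
      have := Nat.floor_le (show 0 ≤ 3 / 2 * x by positivity)
      rw [hl] at this
      exact_mod_cast this
    have hlow : x ≤ l := by
      have := Nat.lt_floor_add_one (3 / 2 * x)
      rw [hl] at this
      push_cast at this
      linarith
    have hl2 : 2 ≤ l := by
      have : (2 : ℝ) ≤ l := by linarith
      exact_mod_cast this
    filter_upwards [eventually_forall_two_mul_pow_le hl2 (k - 1) hδ] with n hn
    intro β A hA
    rw [exponent_eq (by omega)] at hA
    have h := hn ε β A hε.le hA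
    rw [hcast] at h
    have hfactor : 1 / 4 ≤ 2 - ε * (1 + ((k : ℝ) - 1) * (l + 1)) := by
      have h₁ : ε * ((k : ℝ) - 1) * (l + 1) ≤ ε * ((k : ℝ) - 1) * (3 / 2 * x) := by gcongr
      have h₂ : ε ≤ ε * ((k : ℝ) - 1) := le_mul_of_one_le_right hε.le hk1
      linarith
    have hβ : 1 / 4 * x ^ (k - 1) ≤ β := by
      calc 1 / 4 * x ^ (k - 1) ≤ (2 - ε * (1 + ((k : ℝ) - 1) * (l + 1))) * (l : ℝ) ^ (k - 1) := by
            gcongr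
        _ ≤ β := by linarith
    refine ⟨le_trans ?_ hβ, fun _ => hβ⟩
    rw [mul_pow]
    gcongr
    exact pow_le_of_le_one (by norm_num) (by norm_num) (by omega)
  · have hpow : (2 : ℝ) ^ 2 ≤ 2 ^ k := pow_le_pow_right₀ (by norm_num) hk
    have hexp : 1 / ((2 : ℝ) ^ k - 1) < 1 := by
      rw [div_lt_one (by linarith)]
      linarith
    -- Here the claimed bound is at most `1`, and the bipartite gadget (`j = 0`) already gives `β ≥
    -- 2 - ε ≥ 1`; the exponent is below `2`, as that gadget requires.
    filter_upwards [eventually_forall_two_mul_pow_le le_rfl 0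
      (show 0 < 1 - 1 / ((2 : ℝ) ^ k - 1) + δ by linarith)] with n hn
    intro β A hA
    have h := hn ε β A hε.le (by convert hA using 2; norm_num; ring)
    refine ⟨?_, fun h' => absurd h' hsmall⟩
    have hx4 : 1 / 4 * x ≤ 1 := by
      rw [hx, mul_one_div, div_le_one hεk]
      linarith
    have := pow_le_one₀ (n := k - 1) (by positivity) hx4
    norm_num at h
    linarith
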